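/- Let $F:S^1\to S^1$ be a Morse–Smale $C^r$ diffeomorphism of the circle, $r\ge 1$: its nonwandering set $\Omega(F)$ consists of finitely many hyperbolic periodic points, and the stable and unstable manifolds of the periodic points are pairwise transversal. Let $\mathcal M(S^1)$ be the space of Borel probability measures on $S^1$ with the weak-$*$ topology, and let $F_*:\mathcal M(S^1)\to\mathcal M(S^1)$, $F_*\mu=\mu\circ F^{-1}$. Then $$o(F_*)=\sup\{[n^t] : t\in(0,\infty)\}.$$ Here an order of growth $[a(n)]$ is the class of a non-decreasing sequence $a:\{1,2,3,\dots\}\to[0,\infty)$ under the relation $a\approx b$ if and only if $c\,a(n)\le b(n)\le C\,a(n)$ for all $n$, for some constants $c,C>0$. These classes are ordered by $[a(n)]\le[b(n)]$ if and only if there is $C>0$ with $a(n)\le C\,b(n)$ for all $n$. Suprema are taken in the Dedekind–MacNeille completion $\overline{\mathbb O}$ of the partially ordered set $\mathbb O$ of orders of growth. For a continuous self-map $T$ of a compact metric space $(X,d)$, the generalized entropy of $T$ is $$o(T)=\sup\{[\mathrm{Span}(T,n,\varepsilon)] : \varepsilon>0\}\in\overline{\mathbb O},$$ where $\mathrm{Span}(T,n,\varepsilon)$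 is the least cardinality of a set $E\subset X$ such that every $x\in X$ has some $y\in E$ with $\max_{0\le i<n}d(T^ix,T^iy)<\varepsilon$. The equality holds when $o(F_*)$ is computed with any metric on $\mathcal M(S^1)$ that induces the weak-$*$ topology. -/

import Mathlib

open Set Filter Topology MeasureTheory
open scoped NNReal Manifold ContDiff

noncomputable section

/-! ## Orders of growth -/

/-- Non-decreasing sequences `a : {1, 2, 3, …} → [0, ∞)`. -/
structure GrowthSeq where
  /-- the underlying sequence -/
  toFun : ℕ+ → ℝ≥0
  /-- the sequence is non-decreasing -/
  monotone' : Monotone toFun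

/-- `a ≤ b` if there is `C > 0` with `a n ≤ C * b n` for all `n`. -/
instance : Preorder GrowthSeq where
  le a b := ∃ C : ℝ≥0, 0 < C ∧ ∀ n, a.toFun n ≤ C * b.toFun n
  le_refl a := ⟨1, one_pos, fun n => by simp⟩
  le_trans a b c := by
    rintro ⟨C, hC, h⟩ ⟨D, hD, k⟩
    refine ⟨C * D, mul_pos hC hD, fun n => (h n).trans ?_⟩
    rw [mul_assoc]
    gcongr
    exact k n

theorem GrowthSeq.le_iff (a b : GrowthSeq) :
    a ≤ b ↔ ∃ C : ℝ≥0, 0 < C ∧ ∀ n, a.toFun n ≤ C * b.toFun n := Iff.rfl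

/-- Two sequences have the same order of growth if
`c * a n ≤ b n ≤ C * a n` for all `n`, with constants `c, C > 0`. -/
instance GrowthSeq.setoid : Setoid GrowthSeq where
  r a b := ∃ c C : ℝ≥0, 0 < c ∧ 0 < C ∧
    ∀ n, c * a.toFun n ≤ b.toFun n ∧ b.toFun n ≤ C * a.toFun n
  iseqv := by
    have key : ∀ a b : GrowthSeq, (∃ c C : ℝ≥0, 0 < c ∧ 0 < C ∧
        ∀ n, c * a.toFun n ≤ b.toFun n ∧ b.toFun n ≤ C * a.toFun n) ↔ a ≤ b ∧ b ≤ a := by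
      intro a b
      constructor
      · rintro ⟨c, C, hc, hC, h⟩
        refine ⟨⟨c⁻¹, inv_pos.2 hc, fun n => ?_⟩, ⟨C, hC, fun n => (h n).2⟩⟩
        calc a.toFun n = c⁻¹ * (c * a.toFun n) := by
              rw [← mul_assoc, inv_mul_cancel₀ hc.ne', one_mul]
          _ ≤ c⁻¹ * b.toFun n := by
              gcongr
              exact (h n).1
      · rintro ⟨⟨D, hD, h⟩, ⟨C, hC, k⟩⟩
        refine ⟨D⁻¹, C, inv_pos.2 hD, hC, fun n => ⟨?_, k n⟩⟩
        calc D⁻¹ * a.toFun n ≤ D⁻¹ * (D * b.toFun n) := by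
              gcongr
              exact h n
          _ = b.toFun n := by rw [← mul_assoc, inv_mul_cancel₀ hD.ne', one_mul]
    refine ⟨fun a => (key a a).2 ⟨le_rfl, le_rfl⟩, fun {a b} h => ?_, fun {a b c} h k => ?_⟩
    · exact (key b a).2 ((key a b).1 h).symm
    · exact (key a c).2 ⟨((key a b).1 h).1.trans ((key b c).1 k).1,
        ((key b c).1 k).2.trans ((key a b).1 h).2⟩

theorem GrowthSeq.equiv_iff (a b : GrowthSeq) : a ≈ b ↔ a ≤ b ∧ b ≤ a := by
  constructor
  · rintro ⟨c, C, hc, hC, h⟩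
    refine ⟨⟨c⁻¹, inv_pos.2 hc, fun n => ?_⟩, ⟨C, hC, fun n => (h n).2⟩⟩
    calc a.toFun n = c⁻¹ * (c * a.toFun n) := by
          rw [← mul_assoc, inv_mul_cancel₀ hc.ne', one_mul]
      _ ≤ c⁻¹ * b.toFun n := by
          gcongr
          exact (h n).1
  · rintro ⟨⟨D, hD, h⟩, ⟨C, hC, k⟩⟩
    refine ⟨D⁻¹, C, inv_pos.2 hD, hC, fun n => ⟨?_, k n⟩⟩
    calc D⁻¹ * a.toFun n ≤ D⁻¹ * (D * b.toFun n) := by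
          gcongr
          exact h n
      _ = b.toFun n := by rw [← mul_assoc, inv_mul_cancel₀ hD.ne', one_mul]

/-- The space of orders of growth: non-decreasing sequences up to `≈`. -/
def GrowthOrder : Type := Quotient GrowthSeq.setoid

/-- The class `[a(n)]`. -/
def GrowthOrder.mk (a : GrowthSeq) : GrowthOrder := Quotient.mk GrowthSeq.setoid a

instance : PartialOrder GrowthOrder where
  le := Quotient.lift₂ (fun a b : GrowthSeq => a ≤ b) (by
    intro a b a' b' h k
    have h' := (GrowthSeq.equiv_iff _ _).1 h
    have k' := (GrowthSeq.equiv_iff _ _).1 k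
    exact propext ⟨fun l => (h'.2.trans l).trans k'.1, fun l => (h'.1.trans l).trans k'.2⟩)
  le_refl a := by
    induction a using Quotient.inductionOn
    exact le_refl (α := GrowthSeq) _
  le_trans a b c := by
    induction a using Quotient.inductionOn
    induction b using Quotient.inductionOn
    induction c using Quotient.inductionOn
    exact le_trans (α := GrowthSeq)
  le_antisymm a b := by
    induction a using Quotient.inductionOn
    induction b using Quotient.inductionOn
    exact fun h k => Quotient.sound ((GrowthSeq.equiv_iff _ _).2 ⟨h, k⟩)

theorem GrowthOrder.mk_le_mk (a b : GrowthSeq) :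
    GrowthOrder.mk a ≤ GrowthOrder.mk b ↔ a ≤ b := Iff.rfl

/-- The complete space of orders of growth: the Dedekind–MacNeille completion of `GrowthOrder`.
It is a complete lattice, and `DedekindCut.principal` is the inclusion of `GrowthOrder`. -/
abbrev CompleteGrowthOrder : Type := DedekindCut GrowthOrder

/-- The sequence `n ↦ n ^ t`, for real `t > 0`. -/
def polySeq (t : ℝ) (ht : 0 < t) : GrowthSeq where
  toFun n := (n : ℝ≥0) ^ t
  monotone' m n h := NNReal.rpow_le_rpow (by exact_mod_cast h) ht.le

/-- The family of polynomial orders of growth, `{[n ^ t] : t > 0}`. -/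
def polynomialOrders : Set GrowthOrder :=
  {o | ∃ (t : ℝ) (ht : 0 < t), o = GrowthOrder.mk (polySeq t ht)}

/-! ## Generalized entropy -/

section Entropy

variable {X : Type*} [MetricSpace X]

/-- The dynamical distance `d_n(x, y) = max {d (T^i x) (T^i y) : 0 ≤ i < n}`. -/
def dynDist (T : X → X) (n : ℕ+) (x y : X) : ℝ :=
  (Finset.range n).sup' (Finset.nonempty_range_iff.2 n.ne_zero)
    (fun i => dist (T^[i] x) (T^[i] y))

/-- `E` is an `(n, ε)`-spanning set for `T`. -/
def IsSpanningSet (T : X → X) (n : ℕ+) (ε : ℝ) (E : Set X) : Prop :=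
  ∀ x, ∃ y ∈ E, dynDist T n x y < ε

/-- `Span(T, n, ε)`: the minimal cardinality of a finite `(n, ε)`-spanning set. -/
def spanNumber (T : X → X) (n : ℕ+) (ε : ℝ) : ℕ :=
  sInf {k | ∃ E : Finset X, IsSpanningSet T n ε (E : Set X) ∧ E.card = k}

theorem dynDist_lt_iff (T : X → X) (n : ℕ+) (x y : X) (ε : ℝ) :
    dynDist T n x y < ε ↔ ∀ i < (n : ℕ), dist (T^[i] x) (T^[i] y) < ε := by
  simp [dynDist, Finset.sup'_lt_iff]

theorem exists_spanningSet [CompactSpace X] (T : C(X, X)) (n : ℕ+) {ε : ℝ} (hε : 0 < ε) :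
    ∃ E : Finset X, IsSpanningSet T n ε (E : Set X) := by
  have hopen : ∀ y : X, IsOpen {x | dynDist T n x y < ε} := by
    intro y
    have : {x | dynDist T n x y < ε} =
        ⋂ i ∈ Finset.range n, {x | dist (T^[i] x) (T^[i] y) < ε} := by
      ext x
      simp [dynDist_lt_iff]
    rw [this]
    exact isOpen_biInter_finset fun i _ =>
      isOpen_lt ((T.continuous.iterate i).dist continuous_const) continuous_const
  obtain ⟨E, hE⟩ := isCompact_univ.elim_finite_subcover _ hopen (fun x _ => by
    refine mem_iUnion.2 ⟨x, ?_⟩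
    simp [dynDist_lt_iff, hε])
  refine ⟨E, fun x => ?_⟩
  obtain ⟨y, hy, hxy⟩ := mem_iUnion₂.1 (hE (mem_univ x))
  exact ⟨y, hy, hxy⟩

theorem spanNumber_mono [CompactSpace X] (T : C(X, X)) {ε : ℝ} (hε : 0 < ε) :
    Monotone fun n : ℕ+ => (spanNumber T n ε : ℝ≥0) := by
  intro m n h
  obtain ⟨E₀, hE₀⟩ := exists_spanningSet T n hε
  obtain ⟨E, hE, hc⟩ := Nat.sInf_mem
    (s := {k | ∃ E : Finset X, IsSpanningSet T n ε (E : Set X) ∧ E.card = k}) ⟨_, E₀, hE₀, rfl⟩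
  have : spanNumber T m ε ≤ spanNumber T n ε := by
    refine Nat.sInf_le ⟨E, fun x => ?_, hc⟩
    obtain ⟨y, hy, hxy⟩ := hE x
    refine ⟨y, hy, (dynDist_lt_iff ..).2 fun i hi => (dynDist_lt_iff ..).1 hxy i ?_⟩
    exact lt_of_lt_of_le hi (by exact_mod_cast h)
  exact Nat.cast_le.2 this

/-- The sequence `n ↦ Span(T, n, ε)`. -/
def spanSeq [CompactSpace X] (T : C(X, X)) (ε : ℝ) (hε : 0 < ε) : GrowthSeq where
  toFun n := spanNumber T n ε
  monotone' := spanNumber_mono T hε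

/-- The generalized entropy `o(T) = sup {[Span(T, n, ε)] : ε > 0}` of a continuous self-map of a
compact metric space, in the completed space of orders of growth. -/
def generalizedEntropy [CompactSpace X] (T : C(X, X)) : CompleteGrowthOrder :=
  sSup (DedekindCut.principal ''
    {o : GrowthOrder | ∃ (ε : ℝ) (hε : 0 < ε), o = GrowthOrder.mk (spanSeq T ε hε)})

end Entropy

/-- A metric on a topological space that induces the given topology. -/
structure CompatibleMetric (X : Type*) [t : TopologicalSpace X] where
  /-- the metric -/
  metric : MetricSpace X
  /-- its topology is the given one -/
  compatible : t = metric.toPseudoMetricSpace.toUniformSpace.toTopologicalSpace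

/-- The metric space structure, whose topology is the given one by definition. -/
abbrev CompatibleMetric.toMetricSpace {X : Type*} [TopologicalSpace X] (d : CompatibleMetric X) :
    MetricSpace X :=
  d.metric.replaceTopology d.compatible

instance {X : Type*} [TopologicalSpace X] [TopologicalSpace.MetrizableSpace X] :
    Nonempty (CompatibleMetric X) :=
  ⟨⟨TopologicalSpace.metrizableSpaceMetric X, rfl⟩⟩

/-- The generalized entropy of a continuous self-map of a compact metrizable space, computed with
the compatible metric `d`. -/
def generalizedEntropyWith {X : Type*} [TopologicalSpace X] [CompactSpace X]
    (d : CompatibleMetric X) (T : C(X, X)) : CompleteGrowthOrder :=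
  letI := d.toMetricSpace
  generalizedEntropy T

/-! ## The measure-induced map -/

/-- The push-forward map `μ ↦ μ ∘ T⁻¹` on Borel probability measures, with the weak topology. -/
def measureInduced {X : Type*} [TopologicalSpace X] [MeasurableSpace X] [BorelSpace X]
    (T : C(X, X)) : C(ProbabilityMeasure X, ProbabilityMeasure X) where
  toFun μ := μ.map T.continuous.measurable.aemeasurable
  continuous_toFun := ProbabilityMeasure.continuous_map T.continuous

/-! ## Morse–Smale diffeomorphisms of the circle -/

instance : MeasurableSpace Circle := borel Circle

instance : BorelSpace Circle := ⟨rfl⟩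

/-- The set of nonwandering points. -/
def nonwanderingSet {X : Type*} [TopologicalSpace X] (T : X → X) : Set X :=
  {x | ∀ U ∈ 𝓝 x, ∃ n : ℕ, 0 < n ∧ (T^[n] '' U ∩ U).Nonempty}

/-- `p` is a hyperbolic periodic point of `F`: it is periodic, with minimal period `k ≥ 1`, and no
eigenvalue of the derivative of `F^k` at `p` has modulus one. The tangent space at `p` is a real
line, so all eigenvalues are real. (The derivative maps to the tangent space at `F^k p = p`.) -/
def IsHyperbolicPeriodicPt (F : Circle → Circle) (p : Circle) : Prop :=
  p ∈ Function.periodicPts F ∧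
    ∀ c : ℝ, Module.End.HasEigenvalue (R := ℝ) (M := TangentSpace (𝓡 1) p)
      (mfderiv (𝓡 1) (𝓡 1) (F^[Function.minimalPeriod F p]) p).toLinearMap c → |c| ≠ 1

/-- The stable manifold of `p` for `F`, as a set. -/
def stableManifold (F : Circle → Circle) (p : Circle) : Set Circle :=
  {x | Tendsto (fun n : ℕ => dist (F^[n] x) (F^[n] p)) atTop (𝓝 0)}

/-- The tangent space at `x` of a submanifold `W` of the circle, spanned by the velocities of the
`C¹` curves in `W` through `x`. -/
def tangentSpaceOf (W : Set Circle) (x : Circle) : Submodule ℝ (TangentSpace (𝓡 1) x) :=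
  Submodule.span ℝ {v | ∃ γ : ℝ → Circle, ContMDiff 𝓘(ℝ, ℝ) (𝓡 1) 1 γ ∧ (∀ s, γ s ∈ W) ∧
    γ 0 = x ∧ v = mfderiv 𝓘(ℝ, ℝ) (𝓡 1) γ 0 (1 : ℝ)}

/-- A `C^r` diffeomorphism of the circle is Morse–Smale if its nonwandering set consists of
finitely many hyperbolic periodic points, and stable and unstable manifolds of periodic points
(the latter being the stable manifolds for the inverse) meet transversally. -/
structure IsMorseSmale {r : ℕ∞ω} (F : Diffeomorph (𝓡 1) (𝓡 1) Circle Circle r) : Prop where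
  finite_nonwandering : (nonwanderingSet F).Finite
  hyperbolic : ∀ p ∈ nonwanderingSet F, IsHyperbolicPeriodicPt F p
  transverse : ∀ p ∈ Function.periodicPts F, ∀ q ∈ Function.periodicPts F,
    ∀ x ∈ stableManifold F p ∩ stableManifold F.symm q,
      tangentSpaceOf (stableManifold F p) x ⊔ tangentSpaceOf (stableManifold F.symm q) x = ⊤

/-- The continuous map underlying a diffeomorphism of the circle. -/
def Diffeomorph.toCircleMap {r : ℕ∞ω} (F : Diffeomorph (𝓡 1) (𝓡 1) Circle Circle r) :
    C(Circle, Circle) := ⟨F, F.continuous⟩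

end

/-! Upper bound. Arcs test weak convergence on the circle, and the preimage of an arc under a
homeomorphism is an arc. Placing M points at the quantiles of a measure approximates it within 2/M
on all arcs at once (`exists_empiricalMeasure_arc_close`), so the same M points follow its entire
orbit with the same error (`exists_empiricalMeasure_orbit_close`). Thus M depends on ε but not on n.
A circle homeomorphism has spanning sets of size at most nK (`exists_linear_spanning`), and M-tuples
drawn from one of them give at most (nK)^M measures.

Lower bound. Finiteness of the nonwandering set gives a point x with a neighbourhood U that each
orbit visits at most once. For a k-element set S of times below n, put mass 1/k at each F^(-m) x
with m in S. At time m this measure charges U if m is in S, and gives it mass zero otherwise. The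
choose(n, k) measures are therefore separated at a scale depending only on k, and this number is of
order n^k (`exists_pow_le_spanNumber_measureInduced`).

Compactness transfers both estimates to an arbitrary compatible metric. -/

noncomputable section

/-! ## An angular coordinate on the circle -/

/-- The parametrization `t ↦ exp (i (2 π t - π))` of the circle. -/
def circleParam (t : ℝ) : Circle := Circle.exp (2 * Real.pi * t - Real.pi)

/-- The coordinate with values in `(0, 1]` inverse to `circleParam`. -/
def circleCoord (z : Circle) : ℝ := (Complex.arg z + Real.pi) / (2 * Real.pi)

theorem continuous_circleParam : Continuous circleParam :=
  Circle.exp.continuous.comp (by fun_prop)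

theorem circleParam_add_one (t : ℝ) : circleParam (t + 1) = circleParam t := by
  have : 2 * Real.pi * (t + 1) - Real.pi = 2 * Real.pi * t - Real.pi + 2 * Real.pi := by ring
  rw [circleParam, this, Circle.exp_add_two_pi, circleParam]

theorem circleCoord_pos (z : Circle) : 0 < circleCoord z :=
  div_pos (by linarith [Complex.neg_pi_lt_arg z]) Real.two_pi_pos

theorem circleCoord_le_one (z : Circle) : circleCoord z ≤ 1 := by
  rw [circleCoord, div_le_one Real.two_pi_pos]
  linarith [Complex.arg_le_pi z]

theorem circleParam_coord (z : Circle) : circleParam (circleCoord z) = z := by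
  have : 2 * Real.pi * circleCoord z - Real.pi = Complex.arg z := by
    have := Real.pi_pos
    rw [circleCoord]
    field_simp
    ring
  rw [circleParam, this, Circle.exp_arg]

theorem circleCoord_param {t : ℝ} (h0 : 0 < t) (h1 : t ≤ 1) : circleCoord (circleParam t) = t := by
  have hp := Real.pi_pos
  rw [circleCoord, circleParam, Circle.arg_exp (by nlinarith) (by nlinarith)]
  field_simp
  ring

theorem measurable_circleCoord : Measurable circleCoord :=
  ((Complex.measurable_arg.comp
    (Continuous.measurable (f := fun z : Circle => (z : ℂ)) continuous_subtype_val)).add_const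
      _).div_const _

theorem continuousAt_circleCoord {z : Circle} (hz : z ≠ circleParam 1) :
    ContinuousAt circleCoord z := by
  have hs : (z : ℂ) ∈ Complex.slitPlane := by
    rw [Complex.mem_slitPlane_iff_arg]
    refine ⟨fun h => hz ?_, Circle.coe_ne_zero z⟩
    rw [← Circle.exp_arg z, h, circleParam]
    congr 1
    ring
  have h1 : ContinuousAt (fun z : Circle => Complex.arg z) z :=
    ContinuousAt.comp (f := fun z : Circle => (z : ℂ)) (Complex.continuousAt_arg hs)
      continuous_subtype_val.continuousAt
  exact (h1.add_const _).div_const _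

/-- The coordinate jumps only at the cut point `circleParam 1`; away from it, connected sets become
intervals. -/
theorem ordConnected_circleCoord_image {C : Set Circle} (hC : IsPreconnected C)
    (h1 : circleParam 1 ∉ C) : (circleCoord '' C).OrdConnected :=
  (hC.image _ fun _ hz => (continuousAt_circleCoord fun h =>
    h1 (h ▸ hz)).continuousWithinAt).ordConnected

theorem circleCoord_injective : Function.Injective circleCoord :=
  Function.LeftInverse.injective circleParam_coord

/-- A set is an arc if it and its complement are connected; the empty set and the whole circle
are included. -/
def IsCircleArc (A : Set Circle) : Prop := IsPreconnected A ∧ IsPreconnected Aᶜ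

theorem IsCircleArc.preimage {A : Set Circle} (h : IsCircleArc A) (F : Circle ≃ₜ Circle) :
    IsCircleArc (F ⁻¹' A) :=
  ⟨F.isPreconnected_preimage.2 h.1, by
    rw [← preimage_compl]; exact F.isPreconnected_preimage.2 h.2⟩

/-- One of `A` and its complement avoids the cut point and is thus the preimage of an interval under
a measurable coordinate. -/
theorem IsCircleArc.measurableSet {A : Set Circle} (h : IsCircleArc A) : MeasurableSet A := by
  have key : ∀ B : Set Circle, IsPreconnected B → circleParam 1 ∉ B → MeasurableSet B := by
    intro B hB h1
    rw [← preimage_image_eq B circleCoord_injective]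
    exact measurable_circleCoord (ordConnected_circleCoord_image hB h1).measurableSet
  by_cases h1 : circleParam 1 ∈ A
  · exact MeasurableSet.compl_iff.1 (key _ h.2 (by simpa using h1))
  · exact key _ h.1 h1

/-- The complement wraps around the cut; unrolling it past 1 by periodicity exhibits it as the image
of a single interval, hence connected. -/
theorem circleParam_image_Ioc_compl {a b : ℝ} (ha : 0 ≤ a) (hab : a ≤ b) (hb : b ≤ 1) :
    (circleParam '' Ioc a b)ᶜ = circleParam '' Ioc b (a + 1) := by
  have hmem : ∀ {t : ℝ}, 0 < t → t ≤ 1 → (circleParam t ∈ circleParam '' Ioc a b ↔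
      t ∈ Ioc a b) := by
    intro t h0 h1
    refine ⟨?_, fun h => mem_image_of_mem _ h⟩
    rintro ⟨s, hs, hst⟩
    rw [← circleCoord_param h0 h1, ← hst,
      circleCoord_param (ha.trans_lt hs.1) (hs.2.trans hb)]
    exact hs
  ext z
  constructor
  · intro hz
    have h0 := circleCoord_pos z
    have h1 := circleCoord_le_one z
    rw [← circleParam_coord z, mem_compl_iff, hmem h0 h1] at hz
    rcases le_or_gt (circleCoord z) a with h | h
    · exact ⟨circleCoord z + 1, ⟨by linarith, by linarith⟩, by
        rw [circleParam_add_one, circleParam_coord]⟩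
    · exact ⟨circleCoord z, ⟨not_le.1 fun h' => hz ⟨h, h'⟩, by linarith⟩, circleParam_coord z⟩
  · rintro ⟨t, ht, rfl⟩
    rcases le_or_gt t 1 with h | h
    · rw [mem_compl_iff, hmem ((ha.trans hab).trans_lt ht.1) h]
      exact fun h' => (h'.2.trans_lt ht.1).false
    · have := circleParam_add_one (t - 1)
      rw [sub_add_cancel] at this
      rw [this, mem_compl_iff, hmem (by linarith) (by linarith [ht.2])]
      exact fun h' => by linarith [h'.1, ht.2]

theorem isCircleArc_coord_preimage_Ioc {a b : ℝ} (ha : 0 ≤ a) (hab : a ≤ b) (hb : b ≤ 1) :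
    IsCircleArc (circleCoord ⁻¹' Ioc a b) := by
  have : circleCoord ⁻¹' Ioc a b = circleParam '' Ioc a b := by
    ext z
    constructor
    · exact fun hz => ⟨_, hz, circleParam_coord z⟩
    · rintro ⟨t, ht, rfl⟩
      rwa [mem_preimage, circleCoord_param (ha.trans_lt ht.1) (ht.2.trans hb)]
  rw [this]
  refine ⟨isPreconnected_Ioc.image _ continuous_circleParam.continuousOn, ?_⟩
  rw [circleParam_image_Ioc_compl ha hab hb]
  exact isPreconnected_Ioc.image _ continuous_circleParam.continuousOn

/-! ### Grid partitions of the circle -/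

/-- The index `j ∈ {1, …, N}` with `circleCoord z ∈ ((j - 1) / N, j / N]`. -/
def gridIndex (N : ℕ) (z : Circle) : ℕ := ⌈N * circleCoord z⌉₊

theorem gridIndex_pos {N : ℕ} (hN : 0 < N) (z : Circle) : 0 < gridIndex N z :=
  Nat.ceil_pos.2 (mul_pos (Nat.cast_pos.2 hN) (circleCoord_pos z))

theorem gridIndex_le (N : ℕ) (z : Circle) : gridIndex N z ≤ N :=
  Nat.ceil_le.2 (mul_le_of_le_one_right (Nat.cast_nonneg N) (circleCoord_le_one z))

theorem isCircleArc_gridIndex_preimage {N : ℕ} (hN : 0 < N) (j : ℕ) :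
    IsCircleArc (gridIndex N ⁻¹' {j}) := by
  by_cases hj : 0 < j ∧ j ≤ N
  · obtain ⟨i, rfl⟩ : ∃ i, j = i + 1 := ⟨j - 1, by omega⟩
    have hN' : (0 : ℝ) < N := Nat.cast_pos.2 hN
    have hj' : ((i : ℝ) + 1) ≤ N := by exact_mod_cast hj.2
    have : gridIndex N ⁻¹' {i + 1} = circleCoord ⁻¹' Ioc (i / N : ℝ) ((i + 1) / N : ℝ) := by
      ext z
      rw [mem_preimage, mem_singleton_iff, gridIndex, Nat.ceil_eq_iff (by omega), mem_preimage,
        mem_Ioc, div_lt_iff₀' hN', le_div_iff₀' hN']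
      simp
    rw [this]
    exact isCircleArc_coord_preimage_Ioc (by positivity) (by gcongr; linarith)
      ((div_le_one hN').2 hj')
  · have : gridIndex N ⁻¹' {j} = ∅ := by
      ext z
      simp only [mem_preimage, mem_singleton_iff, mem_empty_iff_false, iff_false]
      rintro rfl
      exact hj ⟨gridIndex_pos hN z, gridIndex_le N z⟩
    rw [this]
    exact ⟨isPreconnected_empty, by rw [compl_empty]; exact isPreconnected_univ⟩

/-- Each point is compared with the right endpoint of its cell, less than 1/N away in coordinate;
uniform continuity of `f ∘ circleParam` on [0, 1] does the rest. -/
theorem exists_grid {α : Type*} [PseudoMetricSpace α] {f : Circle → α} (hf : Continuous f) {δ : ℝ}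
    (hδ : 0 < δ) :
    ∃ N : ℕ, 0 < N ∧ ∀ z, dist (f z) (f (circleParam (gridIndex N z / N))) < δ := by
  have huc := isCompact_Icc.uniformContinuousOn_of_continuous (s := Icc (0 : ℝ) 1)
    (hf.comp continuous_circleParam).continuousOn
  obtain ⟨r, hr, h⟩ := Metric.uniformContinuousOn_iff.1 huc δ hδ
  obtain ⟨N, hN⟩ := exists_nat_one_div_lt hr
  refine ⟨N + 1, N.succ_pos, fun z => ?_⟩
  have hN' : (0 : ℝ) < ((N + 1 : ℕ) : ℝ) := by positivity
  have h1 : (gridIndex (N + 1) z : ℝ) / ((N + 1 : ℕ) : ℝ) ≤ 1 :=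
    (div_le_one hN').2 (by exact_mod_cast gridIndex_le _ z)
  have := h (circleCoord z) ⟨(circleCoord_pos z).le, circleCoord_le_one z⟩
    (gridIndex (N + 1) z / ((N + 1 : ℕ) : ℝ)) ⟨by positivity, h1⟩ ?_
  · simpa [circleParam_coord] using this
  · have h2 : ((N + 1 : ℕ) : ℝ) * circleCoord z ≤ gridIndex (N + 1) z := Nat.le_ceil _
    have h3 : (gridIndex (N + 1) z : ℝ) < ((N + 1 : ℕ) : ℝ) * circleCoord z + 1 :=
      Nat.ceil_lt_add_one (mul_pos hN' (circleCoord_pos z)).le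
    rw [Real.dist_eq, abs_sub_comm]
    refine lt_of_le_of_lt ?_ hN
    have h4 : circleCoord z ≤ gridIndex (N + 1) z / ((N + 1 : ℕ) : ℝ) := by
      rw [le_div_iff₀' hN']; exact h2
    rw [abs_of_nonneg (by linarith), sub_le_iff_le_add, div_le_iff₀ hN']
    have h5 : 1 / ((N : ℝ) + 1) * ((N + 1 : ℕ) : ℝ) = 1 := by push_cast; field_simp
    rw [add_mul, h5]
    linarith

open scoped Classical in
/-- The points of the circle with coordinates `1 / N, …, N / N`. -/
def circleGrid (N : ℕ) : Finset Circle :=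
  (Finset.range N).image fun i : ℕ => circleParam ((i + 1) / N)

theorem card_circleGrid_le (N : ℕ) : (circleGrid N).card ≤ N := by
  classical
  exact Finset.card_image_le.trans (Finset.card_range N).le

theorem circleParam_mem_circleGrid {N j : ℕ} (h0 : 0 < j) (hj : j ≤ N) :
    circleParam (j / N) ∈ circleGrid N := by
  classical
  exact Finset.mem_image.2 ⟨j - 1, Finset.mem_range.2 (by omega), by
    have : ((j - 1 : ℕ) : ℝ) + 1 = j := by exact_mod_cast Nat.sub_add_cancel h0
    rw [this]⟩

/-- The grid contains the cut point, so `C` is an interval in the coordinate; passing between two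
cells would force it through some j/N. -/
theorem gridIndex_eq_of_isPreconnected {N : ℕ} (hN : 0 < N) {C : Set Circle}
    (hC : IsPreconnected C) (hd : Disjoint C (circleGrid N)) {x y : Circle} (hx : x ∈ C)
    (hy : y ∈ C) : gridIndex N x = gridIndex N y := by
  have hN' : (0 : ℝ) < N := Nat.cast_pos.2 hN
  have h1 : circleParam 1 ∉ C := by
    have := circleParam_mem_circleGrid hN le_rfl
    rw [div_self hN'.ne'] at this
    exact fun h => disjoint_left.1 hd h this
  have hO := ordConnected_circleCoord_image hC h1
  have key : ∀ x ∈ C, ∀ y ∈ C, gridIndex N y ≤ gridIndex N x := by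
    intro x hx y hy
    by_contra! hlt
    have hj0 := gridIndex_pos hN x
    have hjN := gridIndex_le N x
    have hxj : circleCoord x ≤ gridIndex N x / N := by
      rw [le_div_iff₀' hN']; exact Nat.le_ceil _
    have hjy : gridIndex N x / N ≤ circleCoord y := by
      rw [div_le_iff₀' hN']; exact (Nat.lt_ceil.1 hlt).le
    obtain ⟨w, hw, hwj⟩ := hO.out (mem_image_of_mem _ hx) (mem_image_of_mem _ hy) ⟨hxj, hjy⟩
    refine disjoint_left.1 hd hw ?_
    rw [← circleParam_coord w, hwj]
    exact circleParam_mem_circleGrid hj0 hjN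
  exact le_antisymm (key _ hy _ hx) (key _ hx _ hy)

/-! ### Linear growth for circle homeomorphisms -/

instance : LocallyConnectedSpace Circle :=
  ChartedSpace.locallyConnectedSpace (EuclideanSpace ℝ (Fin 1)) Circle

/-- The `(n, δ)`-spanning sets of a circle homeomorphism grow at most linearly. -/
theorem exists_linear_spanning (F : Circle ≃ₜ Circle) {δ : ℝ} (hδ : 0 < δ) :
    ∃ K : ℕ, ∀ n : ℕ, 0 < n → ∃ E : Finset Circle, E.card ≤ n * K ∧
      ∀ x, ∃ y ∈ E, ∀ i < n, dist (F^[i] x) (F^[i] y) < δ := by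
  obtain ⟨N, hN, hgrid⟩ := exists_grid (f := fun z : Circle => z) continuous_id
    (show 0 < δ / 4 by positivity)
  classical
  refine ⟨N, fun n hn => ?_⟩
  -- All points that hit the grid at some time i < n: until then, the images of a component of the
  -- complement of `E` never meet the grid.
  let E : Finset Circle := (Finset.range n).biUnion fun i => (circleGrid N).image (F.symm^[i])
  have hinv : ∀ i, Function.LeftInverse (F.symm^[i]) (F^[i]) := fun i =>
    Function.LeftInverse.iterate F.symm_apply_apply i
  have hcont : ∀ i, Continuous (F^[i]) := fun i => F.continuous.iterate i
  have hE : ∀ i < n, ∀ x, F^[i] x ∈ circleGrid N → x ∈ E := fun i hi x hx =>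
    Finset.mem_biUnion.2 ⟨i, Finset.mem_range.2 hi, Finset.mem_image.2 ⟨_, hx, hinv i x⟩⟩
  have hEne : E.Nonempty :=
    ⟨circleParam (N / N), hE 0 hn _ (circleParam_mem_circleGrid hN le_rfl)⟩
  refine ⟨E, ?_, fun x => ?_⟩
  · refine (Finset.card_biUnion_le_card_mul _ _ N fun i _ =>
      Finset.card_image_le.trans (card_circleGrid_le N)).trans (by simp)
  by_cases hx : x ∈ E
  · exact ⟨x, hx, fun i _ => by simpa using hδ⟩
  let C := connectedComponentIn (E : Set Circle)ᶜ x
  have hxC : x ∈ C := mem_connectedComponentIn (by simpa using hx)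
  have hCE : C ⊆ (E : Set Circle)ᶜ := connectedComponentIn_subset _ _
  have hCo : IsOpen C := (E.finite_toSet.isClosed.isOpen_compl).connectedComponentIn
  have hC : IsPreconnected C := isPreconnected_connectedComponentIn
  obtain ⟨y, hy⟩ : (frontier C).Nonempty := by
    refine nonempty_frontier_iff.2 ⟨⟨x, hxC⟩, fun h => ?_⟩
    obtain ⟨z, hz⟩ := hEne
    exact hCE (h ▸ mem_univ z) hz
  have hyC : y ∈ closure C := frontier_subset_closure hy
  -- Otherwise the component could be enlarged by its boundary point `y`, placing `y` in the
  -- interior of the open set `C`.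
  have hyE : y ∈ E := by
    by_contra hyE
    have hsub : insert y C ⊆ connectedComponentIn (E : Set Circle)ᶜ x :=
      (hC.subset_closure (subset_insert _ _)
        (insert_subset hyC subset_closure)).subset_connectedComponentIn
        (mem_insert_of_mem _ hxC) (insert_subset (by simpa using hyE) hCE)
    have : y ∈ interior C := by rw [hCo.interior_eq]; exact hsub (mem_insert _ _)
    exact hy.2 this
  refine ⟨y, hyE, fun i hi => ?_⟩
  -- The image of `C` stays in one grid cell; closedness of the ball then extends the estimate to
  -- `y`.
  have hball : ∀ z ∈ C, F^[i] z ∈ Metric.closedBall (F^[i] x) (δ / 2) := by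
    intro z hz
    have hidx := gridIndex_eq_of_isPreconnected hN (hC.image _ (hcont i).continuousOn)
      (disjoint_left.2 (by
        rintro _ ⟨w, hw, rfl⟩ hw'
        exact hCE hw (hE i hi w hw'))) (mem_image_of_mem _ hz) (mem_image_of_mem _ hxC)
    have h1 := hgrid (F^[i] z)
    have h2 := hgrid (F^[i] x)
    rw [hidx] at h1
    rw [Metric.mem_closedBall]
    exact (dist_triangle_right _ _ _).trans (add_lt_add h1 h2).le |>.trans (by linarith)
  have hcl : F^[i] y ∈ Metric.closedBall (F^[i] x) (δ / 2) := by
    have := closure_minimal (s := C) (t := F^[i] ⁻¹' Metric.closedBall (F^[i] x) (δ / 2)) hball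
      (Metric.isClosed_closedBall.preimage (hcont i))
    exact this hyC
  rw [Metric.mem_closedBall, dist_comm] at hcl
  linarith

/-! ## Empirical measures -/

section Empirical

variable {Ω : Type*} [MeasurableSpace Ω]

/-- The uniform probability measure `(1 / k) ∑ δ_{x j}` on a `k`-tuple of points. -/
def empiricalMeasure {k : ℕ} [NeZero k] (x : Fin k → Ω) : ProbabilityMeasure Ω :=
  ⟨(PMF.uniformOfFintype (Fin k)).toMeasure.map x,
    Measure.isProbabilityMeasure_map (Measurable.of_discrete (f := x)).aemeasurable⟩

theorem integral_empiricalMeasure {k : ℕ} [NeZero k] (x : Fin k → Ω) {f : Ω → ℝ}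
    (hf : StronglyMeasurable f) :
    ∫ z, f z ∂(empiricalMeasure x : Measure Ω) = (k : ℝ)⁻¹ * ∑ j, f (x j) := by
  rw [show (empiricalMeasure x : Measure Ω) = (PMF.uniformOfFintype (Fin k)).toMeasure.map x
    from rfl, integral_map (Measurable.of_discrete (f := x)).aemeasurable
    hf.aestronglyMeasurable, PMF.integral_eq_sum, Finset.mul_sum]
  simp

theorem empiricalMeasure_real_apply {k : ℕ} [NeZero k] (x : Fin k → Ω) {A : Set Ω}
    [DecidablePred (· ∈ A)] (hA : MeasurableSet A) :
    (empiricalMeasure x : Measure Ω).real A =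
      (k : ℝ)⁻¹ * (Finset.univ.filter fun j => x j ∈ A).card := by
  have h := integral_empiricalMeasure x (f := A.indicator fun _ => (1 : ℝ))
    (stronglyMeasurable_const.indicator hA)
  rw [integral_indicator_const _ hA, smul_eq_mul, mul_one] at h
  rw [h, Finset.card_filter]
  push_cast
  simp [Set.indicator_apply]

theorem map_empiricalMeasure {Ω' : Type*} [MeasurableSpace Ω'] {k : ℕ} [NeZero k]
    (x : Fin k → Ω) {g : Ω → Ω'} (hg : Measurable g) :
    (empiricalMeasure x : Measure Ω).map g = empiricalMeasure (g ∘ x) :=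
  Measure.map_map hg Measurable.of_discrete

theorem continuous_empiricalMeasure [TopologicalSpace Ω] [OpensMeasurableSpace Ω] {k : ℕ}
    [NeZero k] : Continuous (empiricalMeasure : (Fin k → Ω) → ProbabilityMeasure Ω) := by
  refine ProbabilityMeasure.continuous_iff_forall_continuous_integral.2 fun f => ?_
  simp_rw [integral_empiricalMeasure _ f.continuous.stronglyMeasurable]
  fun_prop

theorem toMeasure_iterate_measureInduced [TopologicalSpace Ω] [BorelSpace Ω] (T : C(Ω, Ω))
    (i : ℕ) (μ : ProbabilityMeasure Ω) :
    (((measureInduced T)^[i] μ : ProbabilityMeasure Ω) : Measure Ω) =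
      (μ : Measure Ω).map (T^[i]) := by
  induction i with
  | zero => simp
  | succ i ih =>
    rw [Function.iterate_succ_apply', Function.iterate_succ']
    have hT := T.continuous.measurable
    rw [← Measure.map_map hT (hT.iterate i), ← ih]
    rfl

theorem iterate_measureInduced_empiricalMeasure [TopologicalSpace Ω] [BorelSpace Ω] (T : C(Ω, Ω))
    (i : ℕ) {k : ℕ} [NeZero k] (x : Fin k → Ω) :
    (measureInduced T)^[i] (empiricalMeasure x) = empiricalMeasure (T^[i] ∘ x) := by
  apply Subtype.ext
  exact (toMeasure_iterate_measureInduced T i _).trans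
    (map_empiricalMeasure x (T.continuous.measurable.iterate i))

end Empirical

/-! ## Quantiles -/

/-- Every probability measure on the line has a `c`-quantile. -/
theorem exists_quantile (m : Measure ℝ) [IsProbabilityMeasure m] (h0 : m.real (Iic 0) = 0)
    (h1 : m.real (Iic 1) = 1) {c : ℝ} (hc0 : 0 < c) (hc1 : c ≤ 1) :
    ∃ s, 0 < s ∧ s ≤ 1 ∧ m.real (Iio s) ≤ c ∧ c ≤ m.real (Iic s) := by
  have hcdf := ProbabilityTheory.cdf_eq_real m
  set G := ProbabilityTheory.cdf m
  let S : Set ℝ := {t | c ≤ G t}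
  have hpos : ∀ t ∈ S, 0 < t := by
    intro t ht
    by_contra! h
    have := (G.mono h).trans_eq ((hcdf 0).trans h0)
    exact (hc0.trans_le (ht.trans this)).false
  have h1S : (1 : ℝ) ∈ S := by simp only [S, mem_ofPred_eq, hcdf, h1, hc1]
  have hbdd : BddBelow S := ⟨0, fun t ht => (hpos t ht).le⟩
  -- Right continuity of the distribution function puts the infimum itself in `S`; the other
  -- inequality uses its left limit.
  have hs : c ≤ G (sInf S) := by
    have hr : Tendsto G (𝓝[>] (sInf S)) (𝓝 (G (sInf S))) :=
      ((G.right_continuous _).mono Ioi_subset_Ici_self)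
    refine ge_of_tendsto hr (eventually_mem_nhdsWithin.mono fun t ht => ?_)
    obtain ⟨u, hu, hut⟩ := exists_lt_of_csInf_lt ⟨1, h1S⟩ ht
    exact le_trans hu (G.mono hut.le)
  refine ⟨sInf S, hpos _ hs, csInf_le hbdd h1S, ?_, by rwa [← hcdf]⟩
  have hm : m (Iio (sInf S)) = ENNReal.ofReal (Function.leftLim G (sInf S) - 0) := by
    rw [← StieltjesFunction.measure_Iio _ (ProbabilityTheory.tendsto_cdf_atBot m),
      ProbabilityTheory.measure_cdf]
  rw [Measure.real, hm, sub_zero, ENNReal.toReal_ofReal']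
  refine max_le ?_ hc0.le
  refine le_of_tendsto (G.mono.tendsto_leftLim _) (eventually_mem_nhdsWithin.mono fun t ht => ?_)
  exact (not_le.1 fun h => (notMem_of_lt_csInf ht hbdd) h).le

/-- Equidistributed quantiles approximate the measure of all lower sets. -/
theorem abs_card_quantile_sub_le (m : Measure ℝ) [IsProbabilityMeasure m] {M : ℕ} (hM : 0 < M)
    {s : Fin M → ℝ} (hs : ∀ j, m.real (Iio (s j)) ≤ ((j : ℝ) + 1) / M ∧
      ((j : ℝ) + 1) / M ≤ m.real (Iic (s j))) {L : Set ℝ} (hL : IsLowerSet L)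
    [DecidablePred (· ∈ L)] :
    |m.real L - (M : ℝ)⁻¹ * (Finset.univ.filter fun j => s j ∈ L).card| ≤ 1 / M := by
  have hM' : (0 : ℝ) < M := Nat.cast_pos.2 hM
  set p := M * m.real L with hp
  have hp0 : 0 ≤ p := by positivity
  have hpM : p ≤ M := mul_le_of_le_one_right hM'.le measureReal_le_one
  set J := Finset.univ.filter fun j => s j ∈ L
  -- Together with `hout`, this says that `J` contains every j with j + 1 < p and none with j + 1 >
  -- p, so its cardinality is within 1 of `p`.
  have hin : ∀ j, s j ∈ L → (j : ℝ) + 1 ≤ p := by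
    intro j hj
    have : Iic (s j) ⊆ L := fun t ht => hL ht hj
    rw [hp, ← div_le_iff₀' hM']
    exact (hs j).2.trans (measureReal_mono this)
  have hout : ∀ j, s j ∉ L → p ≤ (j : ℝ) + 1 := by
    intro j hj
    have : L ⊆ Iio (s j) := fun t ht => not_le.1 fun h => hj (hL h ht)
    rw [hp, ← le_div_iff₀' hM']
    exact (measureReal_mono this).trans (hs j).1
  have hup : (J.card : ℝ) ≤ p := by
    have : J.map Fin.valEmbedding ⊆ Finset.range ⌊p⌋₊ := by
      intro i hi
      obtain ⟨j, hj, rfl⟩ := Finset.mem_map.1 hi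
      have := hin j (Finset.mem_filter.1 hj).2
      exact Finset.mem_range.2 (Nat.le_floor (by push_cast; exact this))
    have := Finset.card_le_card this
    rw [Finset.card_map, Finset.card_range] at this
    exact (Nat.cast_le.2 this).trans (Nat.floor_le hp0)
  have hlow : p ≤ J.card + 1 := by
    have : Finset.range (⌈p⌉₊ - 1) ⊆ J.map Fin.valEmbedding := by
      intro i hi
      have hi' : i + 1 < ⌈p⌉₊ := by have := Finset.mem_range.1 hi; omega
      have hip := Nat.lt_ceil.1 hi'
      have hiM : i < M := by
        have := hip.trans_le hpM
        have : i + 1 < M := by exact_mod_cast this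
        omega
      refine Finset.mem_map.2 ⟨⟨i, hiM⟩, Finset.mem_filter.2 ⟨Finset.mem_univ _, ?_⟩, rfl⟩
      by_contra hL'
      have := hout _ hL'
      push_cast at hip
      exact (hip.trans_le this).false
    have := Finset.card_le_card this
    rw [Finset.card_map, Finset.card_range] at this
    calc p ≤ ⌈p⌉₊ := Nat.le_ceil p
      _ ≤ J.card + 1 := by exact_mod_cast (by omega : ⌈p⌉₊ ≤ J.card + 1)
  have : m.real L = (M : ℝ)⁻¹ * p := by rw [hp]; field_simp
  rw [this, ← mul_sub, abs_mul, abs_of_pos (inv_pos.2 hM'), one_div]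
  exact mul_le_of_le_one_right (inv_pos.2 hM').le (abs_le.2 ⟨by linarith, by linarith⟩)

/-- Every probability measure on the circle is approximated on all arcs by an empirical measure
with a controlled number of points. -/
theorem exists_empiricalMeasure_arc_close (μ : ProbabilityMeasure Circle) (M : ℕ) [NeZero M] :
    ∃ x : Fin M → Circle, ∀ A, IsCircleArc A →
      |(μ : Measure Circle).real A - (empiricalMeasure x : Measure Circle).real A| ≤ 2 / M := by
  classical
  have hM : 0 < M := Nat.pos_of_ne_zero (NeZero.ne M)
  have hM' : (0 : ℝ) < M := Nat.cast_pos.2 hM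
  have hu := measurable_circleCoord
  let m : Measure ℝ := (μ : Measure Circle).map circleCoord
  have : IsProbabilityMeasure m := Measure.isProbabilityMeasure_map hu.aemeasurable
  have hm : ∀ {B : Set ℝ}, MeasurableSet B → m.real B = (μ : Measure Circle).real
      (circleCoord ⁻¹' B) := fun hB => map_measureReal_apply hu hB
  have h0 : m.real (Iic 0) = 0 := by
    rw [hm measurableSet_Iic, show circleCoord ⁻¹' Iic 0 = ∅ from
      eq_empty_of_forall_notMem fun z hz => (circleCoord_pos z).not_ge hz, measureReal_empty]
  have h1 : m.real (Iic 1) = 1 := by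
    rw [hm measurableSet_Iic, show circleCoord ⁻¹' Iic 1 = univ from
      eq_univ_of_forall circleCoord_le_one, probReal_univ]
  choose s hs0 hs1 hs using fun j : Fin M => exists_quantile m h0 h1 (c := ((j : ℝ) + 1) / M)
    (by positivity) ((div_le_one hM').2 (by exact_mod_cast j.2))
  let x : Fin M → Circle := fun j => circleParam (s j)
  have key : ∀ A : Set Circle, IsPreconnected A → MeasurableSet A → circleParam 1 ∉ A →
      |(μ : Measure Circle).real A - (empiricalMeasure x : Measure Circle).real A| ≤ 2 / M := by
    intro A hA hAm hA1
    set I := circleCoord '' A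
    have hIo : I.OrdConnected := ordConnected_circleCoord_image hA hA1
    have hIA : circleCoord ⁻¹' I = A := preimage_image_eq A circleCoord_injective
    have hxs : ∀ j, x j ∈ A ↔ s j ∈ I := by
      intro j
      rw [← hIA, mem_preimage, circleCoord_param (hs0 j) (hs1 j)]
    rcases A.eq_empty_or_nonempty with rfl | hne
    · simp only [measureReal_empty, sub_self, abs_zero]
      positivity
    -- An interval is a difference of two lower sets. Each contributes an error 1/M, whence 2/M.
    let L : Set ℝ := {t | ∃ a ∈ I, t ≤ a}
    let L' : Set ℝ := {t | ∀ a ∈ I, t < a}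
    have hL : IsLowerSet L := fun a b hba ⟨c, hc, hac⟩ => ⟨c, hc, hba.trans hac⟩
    have hL' : IsLowerSet L' := fun a b hba h c hc => hba.trans_lt (h c hc)
    have hsub : L' ⊆ L := fun t ht => by
      obtain ⟨a, ha⟩ := hne
      exact ⟨_, mem_image_of_mem _ ha, (ht _ (mem_image_of_mem _ ha)).le⟩
    have hdiff : I = L \ L' := by
      ext t
      constructor
      · exact fun ht => ⟨⟨t, ht, le_rfl⟩, fun h => (h t ht).false⟩
      · rintro ⟨⟨a, ha, hta⟩, ht⟩
        simp only [L', mem_ofPred_eq, not_forall, not_lt] at ht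
        obtain ⟨b, hb, hbt⟩ := ht
        exact hIo.out hb ha ⟨hbt, hta⟩
    have e1 : (μ : Measure Circle).real A = m.real L - m.real L' := by
      rw [← hIA, ← hm hIo.measurableSet, hdiff,
        measureReal_sdiff hsub hL'.ordConnected.measurableSet]
    have e2 : ((Finset.univ.filter fun j => x j ∈ A).card : ℝ) =
        (Finset.univ.filter fun j => s j ∈ L).card -
          (Finset.univ.filter fun j => s j ∈ L').card := by
      have : (Finset.univ.filter fun j => x j ∈ A) = (Finset.univ.filter fun j => s j ∈ L) \
          (Finset.univ.filter fun j => s j ∈ L') := by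
        ext j
        simp [hxs, hdiff]
      have hss : (Finset.univ.filter fun j => s j ∈ L') ⊆
          (Finset.univ.filter fun j => s j ∈ L) :=
        Finset.monotone_filter_right _ fun j _ hj => hsub hj
      rw [this, Finset.card_sdiff_of_subset hss, Nat.cast_sub (Finset.card_le_card hss)]
    have b1 := abs_card_quantile_sub_le m hM hs hL
    have b2 := abs_card_quantile_sub_le m hM hs hL'
    rw [empiricalMeasure_real_apply x hAm, e1, e2]
    have e3 : (2 : ℝ) / M = 1 / M + 1 / M := by ring
    rw [abs_le] at b1 b2 ⊢
    rw [e3, mul_sub]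
    constructor <;> linarith [b1.1, b1.2, b2.1, b2.2]
  refine ⟨x, fun A hA => ?_⟩
  by_cases h : circleParam 1 ∈ A
  · have := key _ hA.2 hA.measurableSet.compl (by simpa using h)
    rw [probReal_compl_eq_one_sub hA.measurableSet, probReal_compl_eq_one_sub hA.measurableSet,
      sub_sub_sub_cancel_left, abs_sub_comm] at this
    exact this
  · exact key _ hA.1 hA.measurableSet h

/-- Probability measures that almost agree on arcs have almost the same integrals. -/
theorem exists_integral_close_of_arc_close {f : Circle → ℝ} (hf : Continuous f) {c : ℝ}
    (hc : 0 < c) :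
    ∃ η > 0, ∀ μ ν : ProbabilityMeasure Circle,
      (∀ A, IsCircleArc A → |(μ : Measure Circle).real A - (ν : Measure Circle).real A| ≤ η) →
      |∫ z, f z ∂(μ : Measure Circle) - ∫ z, f z ∂(ν : Measure Circle)| < c := by
  obtain ⟨N, hN, hgrid⟩ := exists_grid hf (show 0 < c / 4 by positivity)
  let v : ℕ → ℝ := fun j => f (circleParam (j / N))
  set V := ∑ j ∈ Finset.range (N + 1), |v j|
  have hV0 : 0 ≤ V := Finset.sum_nonneg fun _ _ => abs_nonneg _
  -- A step function on grid arcs within c/4 of `f`; its integral depends only on the masses of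
  -- these arcs.
  let g : Circle → ℝ := fun z => v (gridIndex N z)
  have hgsum : g = fun z => ∑ j ∈ Finset.range (N + 1),
      (gridIndex N ⁻¹' {j}).indicator (fun _ => v j) z := by
    ext z
    rw [Finset.sum_eq_single_of_mem (gridIndex N z)
      (Finset.mem_range.2 (Nat.lt_succ_of_le (gridIndex_le N z)))]
    · simp [g]
    · intro j _ hj
      simp [hj.symm]
  have harc := isCircleArc_gridIndex_preimage hN
  have hint : ∀ (μ : ProbabilityMeasure Circle) (j : ℕ), Integrable
      ((gridIndex N ⁻¹' {j}).indicator (fun _ => v j)) (μ : Measure Circle) := fun μ j =>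
    (integrable_const _).indicator (harc j).measurableSet
  have hgint : ∀ μ : ProbabilityMeasure Circle, Integrable g (μ : Measure Circle) := fun μ => by
    rw [hgsum]; exact integrable_finsetSum _ fun j _ => hint μ j
  have hfint : ∀ μ : ProbabilityMeasure Circle, Integrable f (μ : Measure Circle) := fun μ =>
    hf.integrable_of_hasCompactSupport (HasCompactSupport.of_compactSpace f)
  have hgval : ∀ μ : ProbabilityMeasure Circle, ∫ z, g z ∂(μ : Measure Circle) =
      ∑ j ∈ Finset.range (N + 1), (μ : Measure Circle).real (gridIndex N ⁻¹' {j}) * v j := by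
    intro μ
    rw [hgsum, integral_finsetSum _ fun j _ => hint μ j]
    refine Finset.sum_congr rfl fun j _ => ?_
    rw [integral_indicator_const _ (harc j).measurableSet, smul_eq_mul]
  have hfg : ∀ μ : ProbabilityMeasure Circle,
      |∫ z, f z ∂(μ : Measure Circle) - ∫ z, g z ∂(μ : Measure Circle)| ≤ c / 4 := by
    intro μ
    rw [← integral_sub (hfint μ) (hgint μ)]
    have := norm_integral_le_of_norm_le_const (μ := (μ : Measure Circle)) (C := c / 4)
      (f := fun z => f z - g z) (Eventually.of_forall fun z => (hgrid z).le)
    simpa using this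
  refine ⟨c / (4 * (V + 1)), by positivity, fun μ ν h => ?_⟩
  have hgg : |∫ z, g z ∂(μ : Measure Circle) - ∫ z, g z ∂(ν : Measure Circle)| ≤ c / 4 := by
    rw [hgval, hgval, ← Finset.sum_sub_distrib]
    calc _ ≤ ∑ j ∈ Finset.range (N + 1), c / (4 * (V + 1)) * |v j| := by
          refine (Finset.abs_sum_le_sum_abs _ _).trans (Finset.sum_le_sum fun j _ => ?_)
          rw [← sub_mul, abs_mul]
          exact mul_le_mul_of_nonneg_right (h _ (harc j)) (abs_nonneg _)
      _ = c / (4 * (V + 1)) * V := by rw [← Finset.mul_sum]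
      _ ≤ c / (4 * (V + 1)) * (V + 1) := by gcongr; linarith
      _ = c / 4 := by field_simp
  have h1 := abs_le.1 (hfg μ)
  have h2 := abs_le.1 (hfg ν)
  have h3 := abs_le.1 hgg
  rw [abs_lt]
  constructor <;> linarith [h1.1, h1.2, h2.1, h2.2, h3.1, h3.2]

/-! ## Compatible metrics on spaces of probability measures -/

namespace CompatibleMetric

variable {X : Type*} [TopologicalSpace X]

theorem isOpen_dist_lt (d : CompatibleMetric X) (ε : ℝ) :
    IsOpen {p : X × X | d.metric.dist p.1 p.2 < ε} := by
  let _ := d.toMetricSpace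
  exact isOpen_lt (continuous_dist (α := X)) continuous_const

/-- On a compact space every neighbourhood of the diagonal is an entourage. This makes the argument
independent of the metric. -/
theorem exists_dist_lt_mem [CompactSpace X] (d : CompatibleMetric X) {V : Set (X × X)}
    (hV : IsOpen V) (hdiag : ∀ x, (x, x) ∈ V) :
    ∃ ε > 0, ∀ x y, d.metric.dist x y < ε → (x, y) ∈ V := by
  let _ := d.toMetricSpace
  have hmem : V ∈ uniformity X := by
    rw [← nhdsSet_diagonal_eq_uniformity, hV.mem_nhdsSet]
    rintro ⟨x, y⟩ h
    obtain rfl : x = y := h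
    exact hdiag x
  obtain ⟨ε, hε, h⟩ := Metric.mem_uniformity_dist.1 hmem
  exact ⟨ε, hε, fun x y hxy => h hxy⟩

end CompatibleMetric

/-- On a compact space of probability measures, the weak topology is uniformly controlled by
finitely many integrals. -/
theorem exists_finset_integral_close {Ω : Type*} [TopologicalSpace Ω] [MeasurableSpace Ω]
    [BorelSpace Ω] [HasOuterApproxClosed Ω] [CompactSpace (ProbabilityMeasure Ω)]
    {V : Set (ProbabilityMeasure Ω × ProbabilityMeasure Ω)} (hV : IsOpen V)
    (hdiag : ∀ μ, (μ, μ) ∈ V) :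
    ∃ (s : Finset (BoundedContinuousFunction Ω ℝ)) (c : ℝ), 0 < c ∧
      ∀ μ ν : ProbabilityMeasure Ω,
        (∀ f ∈ s, |∫ z, f z ∂(μ : Measure Ω) - ∫ z, f z ∂(ν : Measure Ω)| < c) → (μ, ν) ∈ V := by
  classical
  let U : BoundedContinuousFunction Ω ℝ × ℕ → Set (ProbabilityMeasure Ω × ProbabilityMeasure Ω) :=
    fun i => {p | 1 / ((i.2 : ℝ) + 1) <
      |∫ z, i.1 z ∂(p.1 : Measure Ω) - ∫ z, i.1 z ∂(p.2 : Measure Ω)|}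
  have hU : ∀ i, IsOpen (U i) := fun i => by
    have hc := ProbabilityMeasure.continuous_integral_boundedContinuousFunction i.1
    exact isOpen_lt continuous_const ((hc.comp continuous_fst).sub (hc.comp continuous_snd)).abs
  -- Pairs off `V` are distinct, so some integral separates them; compactness leaves finitely many
  -- test functions and a least threshold.
  obtain ⟨t, ht⟩ := hV.isClosed_compl.isCompact.elim_finite_subcover U hU (by
    rintro ⟨μ, ν⟩ hμν
    have hne : ∃ f : BoundedContinuousFunction Ω ℝ,
        ∫ z, f z ∂(μ : Measure Ω) ≠ ∫ z, f z ∂(ν : Measure Ω) := by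
      by_contra! h
      obtain rfl : μ = ν := Subtype.ext
        (ext_of_forall_integral_eq_of_IsFiniteMeasure (μ := (μ : Measure Ω)) (ν := (ν : Measure Ω)) h)
      exact hμν (hdiag μ)
    obtain ⟨f, hf⟩ := hne
    obtain ⟨n, hn⟩ := exists_nat_one_div_lt (abs_pos.2 (sub_ne_zero.2 hf))
    exact mem_iUnion.2 ⟨(f, n), hn⟩)
  refine ⟨t.image Prod.fst, 1 / (((t.sup Prod.snd : ℕ) : ℝ) + 1), by positivity,
    fun μ ν h => ?_⟩
  by_contra hμν
  obtain ⟨i, hi, hlt⟩ := mem_iUnion₂.1 (ht hμν)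
  have h1 := h i.1 (Finset.mem_image_of_mem _ hi)
  have h2 : (i.2 : ℝ) ≤ (t.sup Prod.snd : ℕ) := Nat.cast_le.2 (Finset.le_sup hi)
  have h3 : 1 / (((t.sup Prod.snd : ℕ) : ℝ) + 1) ≤ 1 / ((i.2 : ℝ) + 1) := by gcongr
  exact (h1.trans_le h3).not_gt hlt

/-- Along the whole orbit under a circle homeomorphism, every probability measure is approximated
by the orbit of an empirical measure with a fixed number of points. -/
theorem exists_empiricalMeasure_orbit_close (F : Circle ≃ₜ Circle)
    {V : Set (ProbabilityMeasure Circle × ProbabilityMeasure Circle)} (hV : IsOpen V)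
    (hdiag : ∀ μ, (μ, μ) ∈ V) :
    ∃ (M : ℕ) (_ : NeZero M), ∀ μ : ProbabilityMeasure Circle, ∃ x : Fin M → Circle, ∀ i : ℕ,
      ((measureInduced (F : C(Circle, Circle)))^[i] μ, empiricalMeasure (F^[i] ∘ x)) ∈ V := by
  obtain ⟨s, c, hc, hs⟩ := exists_finset_integral_close hV hdiag
  choose η hη0 hη using fun f : BoundedContinuousFunction Circle ℝ =>
    exists_integral_close_of_arc_close f.continuous hc
  obtain ⟨η₀, hη₀, hle⟩ : ∃ η₀ > 0, ∀ f ∈ s, η₀ ≤ η f := by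
    rcases s.eq_empty_or_nonempty with rfl | hne
    · exact ⟨1, one_pos, by simp⟩
    · exact ⟨s.inf' hne η, (Finset.lt_inf'_iff hne).2 fun f _ => hη0 f,
        fun f hf => Finset.inf'_le _ hf⟩
  obtain ⟨N, hN⟩ := exists_nat_one_div_lt (half_pos hη₀)
  refine ⟨N + 1, inferInstance, fun μ => ?_⟩
  obtain ⟨x, hx⟩ := exists_empiricalMeasure_arc_close μ (N + 1)
  refine ⟨x, fun i => hs _ _ fun f hf => hη f _ _ fun A hA => ?_⟩
  -- The mass of `A` at time i is the initial mass of an arc, so the error at time 0 bounds the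
  -- error at all times.
  have hpre : ∀ i : ℕ, IsCircleArc (F^[i] ⁻¹' A) := by
    intro i
    induction i with
    | zero => exact hA
    | succ i ih => rw [Function.iterate_succ, preimage_comp]; exact ih.preimage F
  have hFm : Measurable (F^[i]) := F.continuous.measurable.iterate i
  rw [toMeasure_iterate_measureInduced, ← map_empiricalMeasure x hFm]
  erw [map_measureReal_apply hFm hA.measurableSet]
  rw [map_measureReal_apply hFm hA.measurableSet]
  refine (hx _ (hpre i)).trans (le_trans ?_ (hle f hf))
  have : (2 : ℝ) / ((N + 1 : ℕ) : ℝ) = 2 * (1 / ((N : ℝ) + 1)) := by push_cast; ring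
  rw [this]
  linarith

/-! ## Bounds for spanning numbers -/

section Span

variable {X : Type*} [MetricSpace X] {T : X → X} {n : ℕ+} {ε : ℝ}

theorem spanNumber_le_card {E : Finset X} (hE : IsSpanningSet T n ε (E : Set X)) :
    spanNumber T n ε ≤ E.card :=
  Nat.sInf_le ⟨E, hE, rfl⟩

/-- By the triangle inequality no centre can serve two of the separated points. A finite spanning
set must exist, since `sInf ∅ = 0` in `ℕ`. -/
theorem card_le_spanNumber {ι : Type*} [Fintype ι] (hE : ∃ E : Finset X,
    IsSpanningSet T n ε (E : Set X)) (p : ι → X)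
    (hp : ∀ i j, i ≠ j → ∃ m < (n : ℕ), 2 * ε ≤ dist (T^[m] (p i)) (T^[m] (p j))) :
    Fintype.card ι ≤ spanNumber T n ε := by
  obtain ⟨E₀, hE₀⟩ := hE
  obtain ⟨E, hE, hc⟩ := Nat.sInf_mem
    (s := {k | ∃ E : Finset X, IsSpanningSet T n ε (E : Set X) ∧ E.card = k}) ⟨_, E₀, hE₀, rfl⟩
  rw [spanNumber, ← hc]
  choose y hyE hy using fun i => hE (p i)
  refine (Finset.card_le_card_of_injOn (s := Finset.univ) y (fun i _ => hyE i) ?_)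
  intro i _ j _ hij
  by_contra hne
  obtain ⟨m, hm, hlt⟩ := hp i j hne
  have h1 := (dynDist_lt_iff ..).1 (hy i) m hm
  have h2 := (dynDist_lt_iff ..).1 (hy j) m hm
  rw [hij] at h1
  have := dist_triangle_right (T^[m] (p i)) (T^[m] (p j)) (T^[m] (y j))
  linarith

end Span

/-- The spanning numbers of the map induced by a circle homeomorphism grow at most polynomially. -/
theorem exists_spanNumber_measureInduced_le (F : Circle ≃ₜ Circle)
    (d : CompatibleMetric (ProbabilityMeasure Circle)) {ε : ℝ} (hε : 0 < ε) :
    ∃ M K : ℕ, 0 < M ∧ ∀ n : ℕ+,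
      letI := d.toMetricSpace
      spanNumber (measureInduced (F : C(Circle, Circle))) n ε ≤ (n * K) ^ M := by
  classical
  have hVo := d.isOpen_dist_lt (ε / 2)
  have hVd : ∀ μ : ProbabilityMeasure Circle, (μ, μ) ∈
      {p : ProbabilityMeasure Circle × ProbabilityMeasure Circle |
        d.metric.dist p.1 p.2 < ε / 2} := fun μ => by
    let _ := d.metric
    simpa using hε
  obtain ⟨M, hM, happrox⟩ := exists_empiricalMeasure_orbit_close F hVo hVd
  -- Uniform continuity of `empiricalMeasure` on the compact space of M-tuples; the other ε/2 pays
  -- for replacing μ by an empirical measure.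
  obtain ⟨δ, hδ, hclose⟩ : ∃ δ > 0, ∀ x y : Fin M → Circle, dist x y < δ →
      d.metric.dist (empiricalMeasure x) (empiricalMeasure y) < ε / 2 := by
    have hc := continuous_empiricalMeasure (Ω := Circle) (k := M)
    exact CompatibleMetric.exists_dist_lt_mem ⟨inferInstance, rfl⟩
      (hVo.preimage (hc.prodMap hc)) fun x => hVd _
  obtain ⟨K, hK⟩ := exists_linear_spanning F hδ
  refine ⟨M, K, Nat.pos_of_ne_zero hM.ne, fun n => ?_⟩
  obtain ⟨E, hEc, hE⟩ := hK n n.pos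
  let _ := d.toMetricSpace
  let S : Finset (ProbabilityMeasure Circle) :=
    (Fintype.piFinset fun _ : Fin M => E).image empiricalMeasure
  have hS : IsSpanningSet (measureInduced (F : C(Circle, Circle))) n ε (S : Set _) := by
    intro μ
    obtain ⟨x, hx⟩ := happrox μ
    choose y hyE hy using fun j => hE (x j)
    refine ⟨empiricalMeasure y, Finset.mem_coe.2 (Finset.mem_image_of_mem _
      (Fintype.mem_piFinset.2 hyE)), (dynDist_lt_iff ..).2 fun i hi => ?_⟩
    rw [iterate_measureInduced_empiricalMeasure]
    have h1 : dist ((measureInduced (F : C(Circle, Circle)))^[i] μ)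
      (empiricalMeasure (F^[i] ∘ x)) < ε / 2 := hx i
    have h2 : dist (empiricalMeasure (F^[i] ∘ x)) (empiricalMeasure (F^[i] ∘ y)) < ε / 2 :=
      hclose _ _ ((dist_pi_lt_iff hδ).2 fun j => hy j i hi)
    exact (dist_triangle _ _ _).trans_lt ((add_lt_add h1 h2).trans_eq (add_halves ε))
  calc _ ≤ S.card := spanNumber_le_card hS
    _ ≤ (Fintype.piFinset fun _ : Fin M => E).card := Finset.card_image_le
    _ = E.card ^ M := by simp
    _ ≤ (n * K) ^ M := Nat.pow_le_pow_left hEc M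

/-! ### Lower bound from a wandering point -/

/-- A wandering neighborhood is visited at most once by a full orbit. -/
theorem iterate_symm_notMem_of_wandering {X : Type*} [TopologicalSpace X] (F : X ≃ₜ X) {U : Set X}
    (hU : ∀ n : ℕ, 0 < n → ¬(F^[n] '' U ∩ U).Nonempty) {x : X} (hx : x ∈ U) {i m : ℕ}
    (him : i ≠ m) : F^[i] (F.symm^[m] x) ∉ U := by
  have hinv : ∀ m, F^[m] (F.symm^[m] x) = x := fun m =>
    (Function.LeftInverse.iterate F.apply_symm_apply m) x
  intro h
  rcases lt_or_gt_of_ne him with hlt | hlt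
  · refine hU (m - i) (by omega) ⟨x, ⟨_, h, ?_⟩, hx⟩
    rw [← Function.iterate_add_apply, Nat.sub_add_cancel hlt.le, hinv]
  · refine hU (i - m) (by omega) ⟨_, ⟨x, hx, ?_⟩, h⟩
    rw [← hinv m, ← Function.iterate_add_apply, Nat.sub_add_cancel hlt.le, hinv]

/-- The falling factorial is at least (n + 1 - k)^k, and n ≤ k (n + 1 - k) when 1 ≤ k ≤ n. -/
theorem pow_le_factorial_mul_choose {n k : ℕ} (hkn : k ≤ n) :
    n ^ k ≤ k.factorial * k ^ k * n.choose k := by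
  rcases k.eq_zero_or_pos with rfl | hk
  · simp
  have h1 : (n + 1 - k) ^ k ≤ k.factorial * n.choose k := by
    rw [← Nat.descFactorial_eq_factorial_mul_choose]
    exact Nat.pow_sub_le_descFactorial n k
  have h2 : n ≤ k * (n + 1 - k) := by
    obtain ⟨m, rfl⟩ := Nat.exists_eq_add_of_le hkn
    rw [show k + m + 1 - k = m + 1 by omega]
    nlinarith
  calc n ^ k ≤ (k * (n + 1 - k)) ^ k := Nat.pow_le_pow_left h2 k
    _ = k ^ k * (n + 1 - k) ^ k := mul_pow ..
    _ ≤ k ^ k * (k.factorial * n.choose k) := Nat.mul_le_mul_left _ h1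
    _ = _ := by ring

/-- If a homeomorphism has a wandering point, the spanning numbers of its measure-induced map grow
faster than every power. -/
theorem exists_pow_le_spanNumber_measureInduced {Ω : Type*} [MetricSpace Ω] [CompactSpace Ω]
    [MeasurableSpace Ω] [BorelSpace Ω] (F : Ω ≃ₜ Ω) (hF : nonwanderingSet F ≠ univ)
    (d : CompatibleMetric (ProbabilityMeasure Ω)) (k : ℕ) [NeZero k] :
    ∃ ε : ℝ, 0 < ε ∧ ∃ C : ℕ, 0 < C ∧ ∀ n : ℕ+,
      letI := d.toMetricSpace
      (n : ℕ) ^ k ≤ C * spanNumber (measureInduced (F : C(Ω, Ω))) n ε := by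
  obtain ⟨x, hx⟩ := (ne_univ_iff_exists_notMem _).1 hF
  simp only [nonwanderingSet, mem_ofPred_eq, not_forall, not_exists, not_and] at hx
  obtain ⟨U, hU, hwand⟩ := hx
  obtain ⟨r, hr, hball⟩ := Metric.mem_nhds_iff.1 hU
  have hxU : x ∈ U := mem_of_mem_nhds hU
  let f : BoundedContinuousFunction Ω ℝ :=
    BoundedContinuousFunction.mkOfCompact ⟨fun z => max 0 (1 - dist z x / r), by fun_prop⟩
  have hf : ∀ z, f z = max 0 (1 - dist z x / r) := fun _ => rfl
  have hf0 : ∀ z, 0 ≤ f z := fun z => le_max_left _ _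
  have hfx : f x = 1 := by simp [hf]
  have hfU : ∀ z, z ∉ U → f z = 0 := by
    intro z hz
    have : r ≤ dist z x := not_lt.1 fun h => hz (hball h)
    rw [hf, max_eq_left]
    rw [sub_nonpos, le_div_iff₀ hr]
    linarith
  have hk : (0 : ℝ) < (k : ℝ)⁻¹ := inv_pos.2 (Nat.cast_pos.2 (Nat.pos_of_ne_zero (NeZero.ne k)))
  have hcont := ProbabilityMeasure.continuous_integral_boundedContinuousFunction f
  -- One atom at `x` contributes 1/k to the integral of the bump `f`, so ε-close measures cannot
  -- differ by such an atom.
  obtain ⟨ε, hε, hclose⟩ := d.exists_dist_lt_mem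
    (V := {p | |∫ z, f z ∂(p.1 : Measure Ω) - ∫ z, f z ∂(p.2 : Measure Ω)| < (k : ℝ)⁻¹})
    (isOpen_lt ((hcont.comp continuous_fst).sub (hcont.comp continuous_snd)).abs continuous_const)
    (fun μ => by simpa using hk)
  refine ⟨ε / 2, half_pos hε, k.factorial * k ^ k,
    Nat.mul_pos k.factorial_pos (Nat.pow_pos (Nat.pos_of_ne_zero (NeZero.ne k))), fun n => ?_⟩
  let _ := d.toMetricSpace
  have hspan := exists_spanningSet (measureInduced (F : C(Ω, Ω))) n (half_pos hε)
  let ι := {S : Finset ℕ // S ∈ Finset.powersetCard k (Finset.range n)}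
  have hcard : ∀ S : ι, S.1.card = k := fun S => (Finset.mem_powersetCard.1 S.2).2
  let y : ι → Fin k → Ω := fun S j => F.symm^[S.1.orderEmbOfFin (hcard S) j] x
  have hint : ∀ (S : ι) (i : ℕ), ∫ z, f z ∂(((measureInduced (F : C(Ω, Ω)))^[i]
      (empiricalMeasure (y S)) : ProbabilityMeasure Ω) : Measure Ω) =
        (k : ℝ)⁻¹ * ∑ j, f (F^[i] (y S j)) := by
    intro S i
    rw [iterate_measureInduced_empiricalMeasure,
      integral_empiricalMeasure _ f.continuous.stronglyMeasurable]
    rfl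
  have hsep : ∀ S S' : ι, S ≠ S' → ∃ m < (n : ℕ), 2 * (ε / 2) ≤
      dist ((measureInduced (F : C(Ω, Ω)))^[m] (empiricalMeasure (y S)))
        ((measureInduced (F : C(Ω, Ω)))^[m] (empiricalMeasure (y S'))) := by
    intro S S' hne
    -- Equal cardinality rules out proper inclusion. At time m the first measure has an atom at `x`,
    -- while the second gives `U` no mass.
    obtain ⟨m, hmS, hmS'⟩ : ∃ m ∈ S.1, m ∉ S'.1 := by
      by_contra! h
      exact hne (Subtype.ext (Finset.eq_of_subset_of_card_le h
        ((hcard S').trans (hcard S).symm).le))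
    refine ⟨m, Finset.mem_range.1 ((Finset.mem_powersetCard.1 S.2).1 hmS), ?_⟩
    by_contra! hlt
    have hlt' := hclose _ _ (hlt.trans_eq (mul_div_cancel₀ ε two_ne_zero))
    rw [mem_ofPred_eq, hint, hint] at hlt'
    have h0 : ∑ j, f (F^[m] (y S' j)) = 0 := Finset.sum_eq_zero fun j _ =>
      hfU _ (iterate_symm_notMem_of_wandering F hwand hxU fun h =>
        hmS' (h ▸ Finset.orderEmbOfFin_mem _ _ j))
    have h1 : 1 ≤ ∑ j, f (F^[m] (y S j)) := by
      obtain ⟨j, hj⟩ : m ∈ range (S.1.orderEmbOfFin (hcard S)) := by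
        rw [Finset.range_orderEmbOfFin]; exact hmS
      have : f (F^[m] (y S j)) = 1 := by
        have hinv : F^[m] (F.symm^[m] x) = x :=
          (Function.LeftInverse.iterate F.apply_symm_apply m) x
        simp only [y, hj, hinv, hfx]
      rw [← this]
      exact Finset.single_le_sum (f := fun j => f (F^[m] (y S j))) (fun j _ => hf0 _)
        (Finset.mem_univ j)
    rw [h0, mul_zero, sub_zero, abs_of_nonneg (by positivity)] at hlt'
    exact (le_mul_of_one_le_right hk.le h1).not_gt hlt'
  rcases le_or_gt k n with hkn | hkn
  · refine (pow_le_factorial_mul_choose hkn).trans (Nat.mul_le_mul_left _ ?_)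
    have := card_le_spanNumber hspan (fun S : ι => empiricalMeasure (y S)) hsep
    simpa [ι] using this
  -- For n < k the binomial coefficient vanishes, but n^k is bounded by the constant k! k^k.
  · have h1 : 1 ≤ spanNumber (measureInduced (F : C(Ω, Ω))) n (ε / 2) := by
      have := card_le_spanNumber (ι := Unit) hspan
        (fun _ => empiricalMeasure fun _ : Fin k => x) (fun i j h => (h rfl).elim)
      simpa using this
    calc (n : ℕ) ^ k ≤ k ^ k := Nat.pow_le_pow_left hkn.le k
      _ ≤ k.factorial * k ^ k := Nat.le_mul_of_pos_left _ k.factorial_pos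
      _ ≤ _ := Nat.le_mul_of_pos_right _ h1

theorem Circle.infinite : Infinite Circle := by
  refine Infinite.of_injective (fun n : ℕ => circleParam (1 / ((n : ℝ) + 1))) fun m n h => ?_
  have hp : ∀ n : ℕ, circleCoord (circleParam (1 / ((n : ℝ) + 1))) = 1 / ((n : ℝ) + 1) :=
    fun n => circleCoord_param (by positivity) ((div_le_one (by positivity)).2 (by
      linarith [(Nat.cast_nonneg n : (0 : ℝ) ≤ n)]))
  have h' := congrArg circleCoord h
  simp only [hp] at h'
  rw [one_div, one_div, inv_inj] at h'
  exact_mod_cast add_right_cancel h'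
end

/-- For a Morse–Smale diffeomorphism `F` of the circle, the generalized entropy of the
measure-induced map, computed with any metric `d` inducing the weak topology on the space of Borel
probability measures, is the supremum of the polynomial orders of growth. -/
theorem theorem4 (r : ℕ∞ω) (hr : 1 ≤ r)
    (F : Diffeomorph (𝓡 1) (𝓡 1) Circle Circle r) (hF : IsMorseSmale F)
    (d : CompatibleMetric (ProbabilityMeasure Circle)) :
    generalizedEntropyWith d (measureInduced F.toCircleMap) =
      sSup (DedekindCut.principal '' polynomialOrders) := by
  have hne : nonwanderingSet F.toHomeomorph ≠ univ := fun h => by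
    have := Circle.infinite
    have hfin : (nonwanderingSet F.toHomeomorph).Finite := hF.finite_nonwandering
    exact infinite_univ (h ▸ hfin)
  let _ := d.toMetricSpace
  refine le_antisymm (sSup_le ?_) (sSup_le ?_)
  · rintro _ ⟨_, ⟨ε, hε, rfl⟩, rfl⟩
    obtain ⟨M, K, hM, h⟩ := exists_spanNumber_measureInduced_le F.toHomeomorph d hε
    have hM' : (0 : ℝ) < M := Nat.cast_pos.2 hM
    refine le_trans ?_ (le_sSup ⟨_, ⟨M, hM', rfl⟩, rfl⟩)
    refine DedekindCut.principal_le_principal.2 ((GrowthOrder.mk_le_mk _ _).2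
      -- The added 1 keeps the constant positive even if K = 0.
      ⟨(K : ℝ≥0) ^ M + 1, by positivity, fun n => ?_⟩)
    have hn : ((spanNumber (measureInduced F.toCircleMap) n ε : ℕ) : ℝ≥0) ≤
        (((n : ℕ) * K) ^ M : ℕ) := Nat.cast_le.2 (h n)
    calc ((spanNumber (measureInduced F.toCircleMap) n ε : ℕ) : ℝ≥0) ≤ _ := hn
      _ = (K : ℝ≥0) ^ M * (n : ℝ≥0) ^ (M : ℝ) := by
        rw [NNReal.rpow_natCast]; push_cast; ring
      _ ≤ ((K : ℝ≥0) ^ M + 1) * (n : ℝ≥0) ^ (M : ℝ) := by gcongr; exact le_self_add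
  · rintro _ ⟨_, ⟨t, ht, rfl⟩, rfl⟩
    have : NeZero ⌈t⌉₊ := ⟨(Nat.ceil_pos.2 ht).ne'⟩
    obtain ⟨ε, hε, C, hC, h⟩ :=
      exists_pow_le_spanNumber_measureInduced F.toHomeomorph hne d ⌈t⌉₊
    refine le_trans ?_ (le_sSup ⟨_, ⟨ε, hε, rfl⟩, rfl⟩)
    refine DedekindCut.principal_le_principal.2 ((GrowthOrder.mk_le_mk _ _).2
      ⟨C, Nat.cast_pos.2 hC, fun n => ?_⟩)
    have hn : (((n : ℕ) ^ ⌈t⌉₊ : ℕ) : ℝ≥0) ≤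
        (C * spanNumber (measureInduced F.toCircleMap) n ε : ℕ) := Nat.cast_le.2 (h n)
    have h1 : (1 : ℝ≥0) ≤ (n : ℝ≥0) := by exact_mod_cast (one_le : 1 ≤ n)
    calc (n : ℝ≥0) ^ t ≤ (n : ℝ≥0) ^ ((⌈t⌉₊ : ℕ) : ℝ) :=
          NNReal.rpow_le_rpow_of_exponent_le h1 (Nat.le_ceil t)
      _ = (((n : ℕ) ^ ⌈t⌉₊ : ℕ) : ℝ≥0) := by rw [NNReal.rpow_natCast]; push_cast; rfl
      _ ≤ _ := hn
      _ = C * ((spanNumber (measureInduced F.toCircleMap) n ε : ℕ) : ℝ≥0) := by push_cast; rfl
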